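/- Let $r,k\ge 0$ be integers. For $F\subseteq[r]=\{1,\dots,r\}$ let $\Delta_F=\{x\in\mathbb R^r : x_i\ge 0 \text{ for all } i,\ \sum_i x_i=1,\ x_i=0 \text{ for } i\notin F\}$, and for a family $\mathcal F=(F_1,\dots,F_k)$ of subsets of $[r]$ let $P_{\mathcal F}=\Delta_{F_1}+\cdots+\Delta_{F_k}\subset\mathbb R^r$ be the Minkowski sum. The $f$-polynomial of a polytope $P$ of dimension $d$ is $f_P(q)=\sum_{i=0}^d f_i q^i$, where $f_i$ is the number of $i$-dimensional nonempty faces of $P$ (a face being a subset of $P$ on which some linear function attains its maximum over $P$, so $P$ itself is counted); $f_\emptyset(q)=0$. Let $A\subseteq[r]$ be nonempty such that $N_{\mathcal F}(i)=\{j\in[k] : i\in F_j\}$ is the same set for all $i\in A$, and put $m=\max(A)$. Let $\mathcal F'=(F_1',\dots,F_k')$, where $F_j'=(F_j\setminus A)\cup\{m\}$ if $A\subseteq F_j$ and $F_j'=F_j$ otherwise, and let $P_{\mathcal F''}=\{y\in P_{\mathcal F'} : y_m=0\}$, a possibly empty face of $P_{\mathcal F'}$. Then $$f_{P_{\mathcal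 F}}(q)=f_{\Delta_A}(q)\,f_{P_{\mathcal F'}}(q)-f_{\Delta_A}(q)\,f_{P_{\mathcal F''}}(q)+f_{P_{\mathcal F''}}(q).$$ Equivalently, $P_{\mathcal F}$ has the $f$-polynomial of $\Delta_A\times P_{\mathcal F'}$ with the face $\Delta_A\times P_{\mathcal F''}$ collapsed to $P_{\mathcal F''}$: $$f_{P_{\mathcal F}}(q)=f_{\Delta_A\times P_{\mathcal F'}}(q)-f_{\Delta_A\times P_{\mathcal F''}}(q)+f_{P_{\mathcal F''}}(q).$$ -/

import Mathlib

open Polynomial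

noncomputable section

namespace SimplexSum

/-- The face `Δ_F` of the standard simplex in `ℝ^r`, for `F ⊆ [r]`; it is empty if `F = ∅`. -/
def simplex {r : ℕ} (F : Finset (Fin r)) : Set (Fin r → ℝ) :=
  {x | x ∈ stdSimplex ℝ (Fin r) ∧ ∀ i, i ∉ F → x i = 0}

/-- The Minkowski sum `P_𝓕 = Δ_{F_1} + ⋯ + Δ_{F_k}` of the family `𝓕 = (F_1, …, F_k)`. -/
def minkowskiSum {r k : ℕ} (F : Fin k → Finset (Fin r)) : Set (Fin r → ℝ) :=
  {z | ∃ x : Fin k → Fin r → ℝ, (∀ j, x j ∈ simplex (F j)) ∧ z = ∑ j, x j}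

/-- The membership pattern `N_𝓕(i) = {j ∈ [k] : i ∈ F_j}`. -/
def pattern {r k : ℕ} (F : Fin k → Finset (Fin r)) (i : Fin r) : Finset (Fin k) :=
  Finset.univ.filter (fun j => i ∈ F j)

/-- The family `𝓕'`: each appearance of `A` in a member of `𝓕` is replaced by `{max A}`. -/
def collapse {r k : ℕ} (F : Fin k → Finset (Fin r)) (A : Finset (Fin r)) (hA : A.Nonempty) :
    Fin k → Finset (Fin r) :=
  fun j => if A ⊆ F j then (F j \ A) ∪ {A.max' hA} else F j

/-- `P_𝓕''`: the (possibly empty) face of `P_𝓕'` on which the coordinate `y_m`, `m = max A`,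
vanishes. -/
def collapseFace {r k : ℕ} (F : Fin k → Finset (Fin r)) (A : Finset (Fin r)) (hA : A.Nonempty) :
    Set (Fin r → ℝ) :=
  {y | y ∈ minkowskiSum (collapse F A hA) ∧ y (A.max' hA) = 0}

section FPolynomial

variable {E : Type*} [AddCommGroup E] [Module ℝ E] [TopologicalSpace E]

/-- The dimension of (the affine hull of) a set. -/
def affDim (P : Set E) : ℕ := Module.finrank ℝ (vectorSpan ℝ P)

/-- The nonempty faces of `P`, that is the nonempty subsets of `P` on which some linear function
attains its maximum over `P`. The polytope `P` itself is included. -/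
def faces (P : Set E) : Set (Set E) := {Q | Q.Nonempty ∧ IsExposed ℝ P Q}

/-- The number `f_i` of `i`-dimensional faces of a polytope. -/
def faceCount (P : Set E) (i : ℕ) : ℕ := Set.ncard {Q | Q ∈ faces P ∧ affDim Q = i}

/-- The `f`-polynomial `∑_{i=0}^d f_i q^i` of a polytope of dimension `d`; it is `0` for the
empty set. -/
def fPoly (P : Set E) : ℤ[X] :=
  ∑ i ∈ Finset.range (affDim P + 1), C (faceCount P i : ℤ) * X ^ i

end FPolynomial

end SimplexSum

end

/-! A linear function `c` is maximal on a Minkowski sum exactly where it is maximal on every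
summand, so the nonempty faces of `P_𝓕` correspond to the tuples `(argmax c F_j)_j` (`bijOn_faces`).
Equality of patterns on `A` means that each `F_j` contains or misses `A`, hence `𝓕` arises from `𝓕'`
by substituting `A` for `m`.

Split the face tuples of `P_𝓕`. Those avoiding `A` are the face tuples of `P_𝓕''`
(`mem_faceTuples_sdiff`). Any other one arises from a unique pair `(B, G)`, with `B ⊆ A` nonempty
and `G` a face tuple of `P_𝓕'` involving `m`, by substituting `B` for `m` (`replace_argmax`). Its
dimension is that of `Δ_B` plus that of the face of `G` (`affDim_minkowskiSum_replace`). Since the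
tuples `G` not involving `m` give `P_𝓕''`, this yields `f_P = f_P'' + f_Δ (f_P' - f_P'')`. The
product form follows from multiplicativity of `f`. -/

namespace SimplexSum

/-! ### Dimension of products -/

section Dimension

variable {E E' : Type*} [AddCommGroup E] [Module ℝ E] [AddCommGroup E'] [Module ℝ E']

lemma vectorSpan_prod {s : Set E} {t : Set E'} (hs : s.Nonempty) (ht : t.Nonempty) :
    vectorSpan ℝ (s ×ˢ t) = (vectorSpan ℝ s).prod (vectorSpan ℝ t) := by
  obtain ⟨a, ha⟩ := hs
  obtain ⟨b, hb⟩ := ht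
  apply le_antisymm
  · refine Submodule.span_le.2 ?_
    rintro _ ⟨p, hp, q, hq, rfl⟩
    exact ⟨vsub_mem_vectorSpan ℝ hp.1 hq.1, vsub_mem_vectorSpan ℝ hp.2 hq.2⟩
  · have h1 : vectorSpan ℝ s ≤ (vectorSpan ℝ (s ×ˢ t)).comap (LinearMap.inl ℝ E E') := by
      refine Submodule.span_le.2 ?_
      rintro _ ⟨p, hp, q, hq, rfl⟩
      have := vsub_mem_vectorSpan ℝ (s := s ×ˢ t) (p₁ := (p, b)) (p₂ := (q, b)) ⟨hp, hb⟩ ⟨hq, hb⟩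
      simpa using this
    have h2 : vectorSpan ℝ t ≤ (vectorSpan ℝ (s ×ˢ t)).comap (LinearMap.inr ℝ E E') := by
      refine Submodule.span_le.2 ?_
      rintro _ ⟨p, hp, q, hq, rfl⟩
      have := vsub_mem_vectorSpan ℝ (s := s ×ˢ t) (p₁ := (a, p)) (p₂ := (a, q)) ⟨ha, hp⟩ ⟨ha, hq⟩
      simpa using this
    rintro ⟨u, v⟩ ⟨hu, hv⟩
    simpa using add_mem (Submodule.mem_comap.1 (h1 hu)) (Submodule.mem_comap.1 (h2 hv))

lemma affDim_prod [FiniteDimensional ℝ E] [FiniteDimensional ℝ E'] {s : Set E} {t : Set E'}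
    (hs : s.Nonempty) (ht : t.Nonempty) : affDim (s ×ˢ t) = affDim s + affDim t := by
  let e : ((vectorSpan ℝ s).prod (vectorSpan ℝ t)) ≃ₗ[ℝ] vectorSpan ℝ s × vectorSpan ℝ t :=
    { toFun := fun x => (⟨x.1.1, x.2.1⟩, ⟨x.1.2, x.2.2⟩)
      invFun := fun x => ⟨(x.1.1, x.2.1), x.1.2, x.2.2⟩
      map_add' := fun _ _ => rfl
      map_smul' := fun _ _ => rfl }
  rw [affDim, vectorSpan_prod hs ht, e.finrank_eq, Module.finrank_prod, affDim, affDim]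

end Dimension

/-! ### The `f`-polynomial from an indexing of faces, and products -/

section General

lemma affDim_mono {E : Type*} [AddCommGroup E] [Module ℝ E] [FiniteDimensional ℝ E]
    {P Q : Set E} (h : Q ⊆ P) : affDim Q ≤ affDim P :=
  Submodule.finrank_mono (vectorSpan_mono ℝ h)

lemma maximizers_prod {E E' : Type*} {P : Set E} {Q : Set E'} (l : E → ℝ) (l' : E' → ℝ) :
    {x ∈ P ×ˢ Q | ∀ y ∈ P ×ˢ Q, l y.1 + l' y.2 ≤ l x.1 + l' x.2} =
      {x ∈ P | ∀ y ∈ P, l y ≤ l x} ×ˢ {x ∈ Q | ∀ y ∈ Q, l' y ≤ l' x} := by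
  ext ⟨u, v⟩
  simp only [Set.mem_ofPred_eq, Set.mem_prod, Prod.forall]
  constructor
  · rintro ⟨⟨hu, hv⟩, h⟩
    exact ⟨⟨hu, fun y hy => by linarith [h y v ⟨hy, hv⟩]⟩,
      ⟨hv, fun y hy => by linarith [h u y ⟨hu, hy⟩]⟩⟩
  · rintro ⟨⟨hu, h⟩, hv, h'⟩
    exact ⟨⟨hu, hv⟩, fun y z hyz => add_le_add (h y hyz.1) (h' z hyz.2)⟩

variable {E E' : Type*} [AddCommGroup E] [Module ℝ E] [TopologicalSpace E]
  [AddCommGroup E'] [Module ℝ E'] [TopologicalSpace E']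

lemma mem_faces {P Q : Set E} :
    Q ∈ faces P ↔ Q.Nonempty ∧ ∃ l : StrongDual ℝ E, Q = {x ∈ P | ∀ y ∈ P, l y ≤ l x} :=
  ⟨fun h => ⟨h.1, h.2 h.1⟩, fun h => ⟨h.1, fun _ => h.2⟩⟩

/-- The `f`-polynomial as a sum over an indexing of the nonempty faces. -/
lemma fPoly_eq_sum [FiniteDimensional ℝ E] {ι : Type*} {P : Set E} (s : Finset ι) (g : ι → Set E)
    (h : Set.BijOn g s (faces P)) : fPoly P = ∑ i ∈ s, (X : ℤ[X]) ^ affDim (g i) := by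
  classical
  have hcount (d : ℕ) : faceCount P d = (s.filter fun i => affDim (g i) = d).card := by
    have : {Q | Q ∈ faces P ∧ affDim Q = d} = g '' (s.filter fun i => affDim (g i) = d) := by
      ext Q
      constructor
      · rintro ⟨hQ, hd⟩
        obtain ⟨i, hi, rfl⟩ := h.surjOn hQ
        exact ⟨i, by simpa using ⟨hi, hd⟩, rfl⟩
      · rintro ⟨i, hi, rfl⟩
        simp only [Finset.coe_filter, Set.mem_ofPred_eq] at hi
        exact ⟨h.mapsTo hi.1, hi.2⟩
    rw [faceCount, this, Set.InjOn.ncard_image, Set.ncard_coe_finset]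
    exact h.injOn.mono fun i hi => (Finset.mem_filter.1 hi).1
  rw [fPoly, ← Finset.sum_fiberwise_of_maps_to (g := fun i => affDim (g i))
    (t := Finset.range (affDim P + 1))]
  · refine Finset.sum_congr rfl fun d _ => ?_
    rw [Finset.sum_congr rfl (g := fun _ => (X : ℤ[X]) ^ d)
      fun i hi => by rw [(Finset.mem_filter.1 hi).2], hcount]
    simp
  -- A face lies in `P`, so the cutoff at `affDim P` loses no term.
  · intro i hi
    obtain ⟨-, l, hl⟩ := mem_faces.1 (h.mapsTo hi)
    rw [Finset.mem_range_succ_iff]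
    exact affDim_mono (hl ▸ Set.sep_subset _ _)

/-- The `f`-polynomial is multiplicative, given that the factors have finitely many faces. -/
lemma fPoly_prod [ContinuousAdd E] [ContinuousAdd E'] [FiniteDimensional ℝ E]
    [FiniteDimensional ℝ E'] {ι κ : Type*} {P : Set E}
    {Q : Set E'} (s : Finset ι) (g : ι → Set E) (hg : Set.BijOn g s (faces P))
    (t : Finset κ) (g' : κ → Set E') (hg' : Set.BijOn g' t (faces Q)) :
    fPoly (P ×ˢ Q) = fPoly P * fPoly Q := by
  have hbij : Set.BijOn (fun p : ι × κ => g p.1 ×ˢ g' p.2) (s ×ˢ t : Finset (ι × κ))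
      (faces (P ×ˢ Q)) := by
    refine ⟨?_, ?_, ?_⟩
    · intro p hp
      have hp := Finset.mem_product.1 hp
      obtain ⟨h1, l, hl⟩ := mem_faces.1 (hg.mapsTo hp.1)
      obtain ⟨h1', l', hl'⟩ := mem_faces.1 (hg'.mapsTo hp.2)
      refine mem_faces.2 ⟨h1.prod h1', l.comp (.fst ℝ E E') + l'.comp (.snd ℝ E E'), ?_⟩
      simp only [hl, hl', ← maximizers_prod]
      rfl
    · intro p hp q hq h
      have hp := Finset.mem_product.1 hp
      have hq := Finset.mem_product.1 hq
      rcases (Set.prod_eq_prod_iff_of_nonempty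
        ((hg.mapsTo hp.1).1.prod (hg'.mapsTo hp.2).1)).1 h with ⟨h1, h2⟩
      exact Prod.ext (hg.injOn hp.1 hq.1 h1) (hg'.injOn hp.2 hq.2 h2)
    · intro R hR
      obtain ⟨h1, l, hl⟩ := mem_faces.1 hR
      have hR' : R = {x ∈ P | ∀ y ∈ P, l.comp (.inl ℝ E E') y ≤ l.comp (.inl ℝ E E') x} ×ˢ
          {x ∈ Q | ∀ y ∈ Q, l.comp (.inr ℝ E E') y ≤ l.comp (.inr ℝ E E') x} := by
        rw [← maximizers_prod, hl]
        have (x : E × E') : l x = l.comp (.inl ℝ E E') x.1 + l.comp (.inr ℝ E E') x.2 := by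
          simp [← map_add]
        simp only [this]
      rw [hR'] at h1
      obtain ⟨i, hi, hi'⟩ := hg.surjOn (mem_faces.2 ⟨h1.fst, _, rfl⟩)
      obtain ⟨j, hj, hj'⟩ := hg'.surjOn (mem_faces.2 ⟨h1.snd, _, rfl⟩)
      exact ⟨(i, j), Finset.mem_coe.2 (Finset.mem_product.2 ⟨hi, hj⟩),
        (by simp only [hi', hj', hR'])⟩
  rw [fPoly_eq_sum _ _ hbij, fPoly_eq_sum _ _ hg, fPoly_eq_sum _ _ hg', Finset.sum_mul_sum,
    Finset.sum_product]
  refine Finset.sum_congr rfl fun i hi => Finset.sum_congr rfl fun j hj => ?_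
  rw [affDim_prod (hg.mapsTo hi).1 (hg'.mapsTo hj).1, pow_add]

end General

/-! ### Faces of sums of simplices as tuples of maximizers -/

variable {r k : ℕ}

/-- The elements of `F` on which `c` attains its maximum over `F`. -/
noncomputable def argmax (c : Fin r → ℝ) (F : Finset (Fin r)) : Finset (Fin r) := by
  classical exact F.filter fun i => ∀ i' ∈ F, c i' ≤ c i

lemma mem_argmax {c : Fin r → ℝ} {F : Finset (Fin r)} {i : Fin r} :
    i ∈ argmax c F ↔ i ∈ F ∧ ∀ i' ∈ F, c i' ≤ c i := by
  simp [argmax]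

lemma argmax_subset (c : Fin r → ℝ) (F : Finset (Fin r)) : argmax c F ⊆ F :=
  fun _ h => (mem_argmax.1 h).1

lemma argmax_nonempty (c : Fin r → ℝ) {F : Finset (Fin r)} (h : F.Nonempty) :
    (argmax c F).Nonempty := by
  obtain ⟨i, hi, h⟩ := F.exists_max_image c h
  exact ⟨i, mem_argmax.2 ⟨hi, h⟩⟩

/-- The tuples of maximizers on the members of `F`, which index the nonempty faces of the
Minkowski sum. -/
noncomputable def faceTuples (F : Fin k → Finset (Fin r)) : Finset (Fin k → Finset (Fin r)) := by
  classical exact Finset.univ.filter fun G =>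
    (∀ j, (F j).Nonempty) ∧ ∃ c : Fin r → ℝ, G = fun j => argmax c (F j)

lemma mem_faceTuples {F G : Fin k → Finset (Fin r)} :
    G ∈ faceTuples F ↔ (∀ j, (F j).Nonempty) ∧ ∃ c : Fin r → ℝ, G = fun j => argmax c (F j) := by
  simp [faceTuples]

lemma faceTuples_nonempty {F G : Fin k → Finset (Fin r)} (h : G ∈ faceTuples F) (j : Fin k) :
    (G j).Nonempty := by
  obtain ⟨hF, c, rfl⟩ := mem_faceTuples.1 h
  exact argmax_nonempty c (hF j)

lemma single_mem_simplex {F : Finset (Fin r)} {i : Fin r} (h : i ∈ F) :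
    (Pi.single i 1 : Fin r → ℝ) ∈ simplex F := by
  refine ⟨single_mem_stdSimplex ℝ i, fun j hj => ?_⟩
  rw [Pi.single_eq_of_ne]
  rintro rfl
  exact hj h

lemma simplex_mono {F G : Finset (Fin r)} (h : F ⊆ G) : simplex F ⊆ simplex G :=
  fun _ hx => ⟨hx.1, fun i hi => hx.2 i fun h' => hi (h h')⟩

lemma nonempty_of_mem_simplex {F : Finset (Fin r)} {x : Fin r → ℝ} (h : x ∈ simplex F) :
    F.Nonempty := by
  by_contra hF
  rw [Finset.not_nonempty_iff_eq_empty] at hF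
  have := h.1.2
  rw [Finset.sum_eq_zero fun i _ => h.2 i (by simp [hF])] at this
  exact zero_ne_one this

lemma sum_single_mem_minkowskiSum {F : Fin k → Finset (Fin r)} {i : Fin k → Fin r}
    (h : ∀ j, i j ∈ F j) : ∑ j, (Pi.single (i j) 1 : Fin r → ℝ) ∈ minkowskiSum F :=
  ⟨_, fun j => single_mem_simplex (h j), rfl⟩

lemma minkowskiSum_nonempty {F : Fin k → Finset (Fin r)} (h : ∀ j, (F j).Nonempty) :
    (minkowskiSum F).Nonempty :=
  ⟨_, sum_single_mem_minkowskiSum fun j => (h j).choose_spec⟩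

lemma nonempty_of_mem_minkowskiSum {F : Fin k → Finset (Fin r)} {x : Fin r → ℝ}
    (h : x ∈ minkowskiSum F) (j : Fin k) : (F j).Nonempty := by
  obtain ⟨y, hy, -⟩ := h
  exact nonempty_of_mem_simplex (hy j)

lemma minkowskiSum_mono {F G : Fin k → Finset (Fin r)} (h : ∀ j, F j ⊆ G j) :
    minkowskiSum F ⊆ minkowskiSum G := by
  rintro z ⟨x, hx, rfl⟩
  exact ⟨x, fun j => simplex_mono (h j) (hx j), rfl⟩

section Maximizers

variable {c : Fin r → ℝ} {F : Finset (Fin r)} {i : Fin r} {x : Fin r → ℝ}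

lemma dotProduct_le (hi : i ∈ argmax c F) (hx : x ∈ simplex F) : c ⬝ᵥ x ≤ c i := by
  rw [mem_argmax] at hi
  calc c ⬝ᵥ x ≤ ∑ a, c i * x a := by
        refine Finset.sum_le_sum fun a _ => ?_
        by_cases ha : a ∈ F
        · exact mul_le_mul_of_nonneg_right (hi.2 a ha) (hx.1.1 a)
        · simp [hx.2 a ha]
    _ = c i := by rw [← Finset.mul_sum, hx.1.2, mul_one]

lemma dotProduct_eq (hi : i ∈ argmax c F) (hx : x ∈ simplex (argmax c F)) : c ⬝ᵥ x = c i := by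
  calc c ⬝ᵥ x = ∑ a, c i * x a := by
        refine Finset.sum_congr rfl fun a _ => ?_
        by_cases ha : a ∈ argmax c F
        · rw [le_antisymm ((mem_argmax.1 hi).2 a (argmax_subset _ _ ha))
            ((mem_argmax.1 ha).2 i (argmax_subset _ _ hi))]
        · simp [hx.2 a ha]
    _ = c i := by rw [← Finset.mul_sum, hx.1.2, mul_one]

lemma mem_simplex_argmax (hi : i ∈ argmax c F) (hx : x ∈ simplex F) (h : c ⬝ᵥ x = c i) :
    x ∈ simplex (argmax c F) := by
  refine ⟨hx.1, fun a ha => ?_⟩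
  by_cases haF : a ∈ F
  swap
  · exact hx.2 a haF
  have hi' := mem_argmax.1 hi
  -- All terms are nonnegative, so each vanishes: `x` carries no weight where `c` is below its
  -- maximum.
  have h0 : ∑ b, (c i - c b) * x b = 0 := by
    simp only [sub_mul, Finset.sum_sub_distrib, ← Finset.mul_sum, hx.1.2]
    rw [dotProduct] at h
    linarith
  have h1 := (Finset.sum_eq_zero_iff_of_nonneg fun b _ => ?_).1 h0 a (Finset.mem_univ a)
  · refine (mul_eq_zero.1 h1).resolve_left fun h2 => ha ?_
    refine mem_argmax.2 ⟨haF, fun b hb => (hi'.2 b hb).trans ?_⟩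
    linarith
  · by_cases hb : b ∈ F
    · exact mul_nonneg (sub_nonneg.2 (hi'.2 b hb)) (hx.1.1 b)
    · simp [hx.2 b hb]

end Maximizers

lemma mem_minkowskiSum_argmax_iff {c : Fin r → ℝ} {F : Fin k → Finset (Fin r)} {i : Fin k → Fin r}
    (hi : ∀ j, i j ∈ argmax c (F j)) {z : Fin r → ℝ} :
    z ∈ minkowskiSum (fun j => argmax c (F j)) ↔ z ∈ minkowskiSum F ∧ c ⬝ᵥ z = ∑ j, c (i j) := by
  constructor
  · intro hz
    refine ⟨minkowskiSum_mono (fun j => argmax_subset _ _) hz, ?_⟩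
    obtain ⟨x, hx, rfl⟩ := hz
    rw [dotProduct_sum]
    exact Finset.sum_congr rfl fun j _ => dotProduct_eq (hi j) (hx j)
  · rintro ⟨⟨x, hx, rfl⟩, h⟩
    rw [dotProduct_sum] at h
    have := (Finset.sum_eq_sum_iff_of_le fun j _ => dotProduct_le (hi j) (hx j)).1 h
    exact ⟨x, fun j => mem_simplex_argmax (hi j) (hx j) (this j (Finset.mem_univ j)), rfl⟩

lemma minkowskiSum_argmax (c : Fin r → ℝ) {F : Fin k → Finset (Fin r)}
    (hF : ∀ j, (F j).Nonempty) : minkowskiSum (fun j => argmax c (F j)) =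
      {x ∈ minkowskiSum F | ∀ y ∈ minkowskiSum F, c ⬝ᵥ y ≤ c ⬝ᵥ x} := by
  choose i hi using fun j => argmax_nonempty c (hF j)
  have hle {y : Fin r → ℝ} (hy : y ∈ minkowskiSum F) : c ⬝ᵥ y ≤ ∑ j, c (i j) := by
    obtain ⟨x, hx, rfl⟩ := hy
    rw [dotProduct_sum]
    exact Finset.sum_le_sum fun j _ => dotProduct_le (hi j) (hx j)
  ext z
  rw [mem_minkowskiSum_argmax_iff hi]
  refine and_congr_right fun hz => ⟨fun h y hy => h ▸ hle hy, fun h => (hle hz).antisymm ?_⟩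
  have h' := sum_single_mem_minkowskiSum hi
  rw [← ((mem_minkowskiSum_argmax_iff hi).1 h').2]
  exact h _ ((mem_minkowskiSum_argmax_iff hi).1 h').1

/-- Gives injectivity of the indexing by tuples. Given `a` in the `j`-th member, a sum of unit
vectors using `a` in position `j` lies in the first face, hence in the second; attaining the total
maximum of `c'` forces `a` to attain it on `F j`. -/
lemma argmax_le_of_minkowskiSum_subset {c c' : Fin r → ℝ} {F : Fin k → Finset (Fin r)}
    (h : minkowskiSum (fun j => argmax c (F j)) ⊆ minkowskiSum fun j => argmax c' (F j))
    (hF : ∀ j, (F j).Nonempty) (j : Fin k) : argmax c (F j) ⊆ argmax c' (F j) := by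
  intro a ha
  choose i hi using fun j => argmax_nonempty c (hF j)
  choose i' hi' using fun j => argmax_nonempty c' (hF j)
  have hu (l : Fin k) : Function.update i j a l ∈ argmax c (F l) := by
    by_cases hl : l = j
    · subst hl
      simpa using ha
    · simpa [hl] using hi l
  have h1 := ((mem_minkowskiSum_argmax_iff hi').1 (h (sum_single_mem_minkowskiSum hu))).2
  rw [dotProduct_sum] at h1
  simp only [dotProduct_single, mul_one] at h1
  have h2 := (Finset.sum_eq_sum_iff_of_le fun l _ =>
    (mem_argmax.1 (hi' l)).2 _ (argmax_subset _ _ (hu l))).1 h1 j (Finset.mem_univ j)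
  rw [Function.update_self] at h2
  exact mem_argmax.2 ⟨argmax_subset _ _ ha, fun b hb => h2 ▸ (mem_argmax.1 (hi' j)).2 b hb⟩

lemma strongDual_eq_dotProduct (l : StrongDual ℝ (Fin r → ℝ)) (x : Fin r → ℝ) :
    l x = (fun i => l (Pi.single i 1)) ⬝ᵥ x := by
  conv_lhs => rw [pi_eq_sum_univ' x, map_sum]
  refine Finset.sum_congr rfl fun i _ => ?_
  rw [map_smul, smul_eq_mul, mul_comm]

lemma exists_strongDual (c : Fin r → ℝ) : ∃ l : StrongDual ℝ (Fin r → ℝ), ∀ x, l x = c ⬝ᵥ x :=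
  ⟨LinearMap.toContinuousLinearMap (dotProductBilin ℝ ℝ c), fun _ => rfl⟩

/-- If some `F j` is empty, so is the sum, and there are neither tuples nor faces. -/
lemma bijOn_faces (F : Fin k → Finset (Fin r)) :
    Set.BijOn minkowskiSum (faceTuples F : Set (Fin k → Finset (Fin r)))
      (faces (minkowskiSum F)) := by
  refine ⟨?_, ?_, ?_⟩
  · intro G hG
    refine mem_faces.2 ⟨minkowskiSum_nonempty (faceTuples_nonempty hG), ?_⟩
    obtain ⟨hF, c, rfl⟩ := mem_faceTuples.1 hG
    obtain ⟨l, hl⟩ := exists_strongDual c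
    exact ⟨l, by simp only [hl, minkowskiSum_argmax c hF]⟩
  · intro G hG G' hG' h
    obtain ⟨hF, c, rfl⟩ := mem_faceTuples.1 hG
    obtain ⟨-, c', rfl⟩ := mem_faceTuples.1 hG'
    funext j
    exact (argmax_le_of_minkowskiSum_subset h.subset hF j).antisymm
      (argmax_le_of_minkowskiSum_subset h.superset hF j)
  · intro Q hQ
    obtain ⟨⟨x, hx⟩, l, rfl⟩ := mem_faces.1 hQ
    have hF := nonempty_of_mem_minkowskiSum hx.1
    refine ⟨_, mem_faceTuples.2 ⟨hF, fun i => l (Pi.single i 1), rfl⟩, ?_⟩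
    rw [minkowskiSum_argmax _ hF]
    simp only [← strongDual_eq_dotProduct]

lemma fPoly_minkowskiSum (F : Fin k → Finset (Fin r)) :
    fPoly (minkowskiSum F) = ∑ G ∈ faceTuples F, (X : ℤ[X]) ^ affDim (minkowskiSum G) :=
  fPoly_eq_sum _ _ (bijOn_faces F)

lemma simplex_eq_minkowskiSum (A : Finset (Fin r)) :
    simplex A = minkowskiSum fun _ : Fin 1 => A := by
  ext x
  constructor
  · exact fun hx => ⟨fun _ => x, fun _ => hx, by simp⟩
  · rintro ⟨y, hy, rfl⟩
    simpa using hy 0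

lemma exists_argmax_eq {A B : Finset (Fin r)} (hB : B.Nonempty) (h : B ⊆ A) :
    ∃ c, argmax c A = B := by
  -- The indicator function of `B` is a suitable functional.
  classical
  obtain ⟨b, hb⟩ := hB
  refine ⟨fun i => if i ∈ B then 1 else 0, ?_⟩
  ext i
  rw [mem_argmax]
  constructor
  · rintro ⟨-, hi⟩
    by_contra hiB
    have := hi b (h hb)
    simp only [hb, hiB, if_true, if_false] at this
    linarith
  · intro hi
    refine ⟨h hi, fun j _ => ?_⟩
    simp only [hi, if_true]
    split_ifs <;> norm_num

lemma bijOn_faces_simplex (A : Finset (Fin r)) :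
    Set.BijOn simplex (A.powerset.filter Finset.Nonempty) (faces (simplex A)) := by
  refine ⟨?_, ?_, ?_⟩
  · intro B hB
    obtain ⟨hBA, hB⟩ : B ⊆ A ∧ B.Nonempty := by simpa using hB
    obtain ⟨c, rfl⟩ := exists_argmax_eq hB hBA
    rw [simplex_eq_minkowskiSum, simplex_eq_minkowskiSum]
    exact (bijOn_faces _).mapsTo (mem_faceTuples.2 ⟨fun _ => hB.mono hBA, c, rfl⟩)
  · have hsub {B C : Finset (Fin r)} (h : simplex B = simplex C) : B ⊆ C := fun i hi => by
      by_contra hiC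
      simpa using (h ▸ single_mem_simplex hi : Pi.single i 1 ∈ simplex C).2 i hiC
    exact fun B _ C _ h => (hsub h).antisymm (hsub h.symm)
  · intro Q hQ
    rw [simplex_eq_minkowskiSum] at hQ
    obtain ⟨G, hG, rfl⟩ := (bijOn_faces _).surjOn hQ
    obtain ⟨hA, c, rfl⟩ := mem_faceTuples.1 hG
    refine ⟨argmax c A, ?_, simplex_eq_minkowskiSum _⟩
    simpa using ⟨argmax_subset c A, argmax_nonempty c (hA 0)⟩

/-! ### Substituting a set for `m`, and its effect on maximizers -/

/-- Replace the element `m` of `G` by the elements of `B`. -/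
def replace (m : Fin r) (B G : Finset (Fin r)) : Finset (Fin r) :=
  if m ∈ G then G.erase m ∪ B else G

lemma mem_replace_of_mem {m i : Fin r} {B G : Finset (Fin r)} (h : m ∈ G) :
    i ∈ replace m B G ↔ i ≠ m ∧ i ∈ G ∨ i ∈ B := by
  simp [replace, h]

lemma replace_of_notMem {m : Fin r} {B G : Finset (Fin r)} (h : m ∉ G) :
    replace m B G = G := by
  simp [replace, h]

lemma replace_nonempty_iff {m : Fin r} {B G : Finset (Fin r)} (hB : B.Nonempty) :
    (replace m B G).Nonempty ↔ G.Nonempty := by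
  by_cases h : m ∈ G
  · obtain ⟨b, hb⟩ := hB
    exact ⟨fun _ => ⟨m, h⟩, fun _ => ⟨b, (mem_replace_of_mem h).2 (.inr hb)⟩⟩
  · rw [replace_of_notMem h]

lemma argmax_congr {c c' : Fin r → ℝ} {G : Finset (Fin r)} (h : ∀ i ∈ G, c i = c' i) :
    argmax c G = argmax c' G := by
  ext i
  rw [mem_argmax, mem_argmax]
  refine and_congr_right fun hi => forall₂_congr fun j hj => ?_
  rw [h i hi, h j hj]

/-- Here `B` is the set of maximizers of `c` on `A`, and `c'` gives `m` that maximal value.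
Maximizing `c` after the substitution then amounts to maximizing `c'` first and, if `m` is among the
maximizers, expanding it to `B`. -/
lemma replace_argmax {m : Fin r} {A B G : Finset (Fin r)} {c c' : Fin r → ℝ}
    (hG : ∀ i ∈ G, i ∈ A → i = m) (hBA : B ⊆ A) (hB : B.Nonempty)
    (hoff : ∀ i ∉ A, c i = c' i) (heq : ∀ i ∈ B, c i = c' m)
    (hlt : ∀ i ∈ A, i ∉ B → c i < c' m) :
    replace m B (argmax c' G) = argmax c (replace m A G) := by
  by_cases hm : m ∈ G
  swap
  · rw [replace_of_notMem hm, replace_of_notMem fun h => hm (argmax_subset _ _ h)]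
    exact argmax_congr fun i hi => (hoff i fun h => hm (hG i hi h ▸ hi)).symm
  have hA : ∀ i ∈ A, c i ≤ c' m := fun i hi => by
    by_cases hiB : i ∈ B
    exacts [(heq i hiB).le, (hlt i hi hiB).le]
  -- The two functions have the same upper bounds, hence the same maximum.
  have hub (v : ℝ) : (∀ x ∈ replace m A G, c x ≤ v) ↔ ∀ x ∈ G, c' x ≤ v := by
    constructor
    · intro h x hx
      by_cases hxm : x = m
      · obtain ⟨b, hb⟩ := hB
        rw [hxm, ← heq b hb]
        exact h b ((mem_replace_of_mem hm).2 (.inr (hBA hb)))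
      · rw [← hoff x fun hxA => hxm (hG x hx hxA)]
        exact h x ((mem_replace_of_mem hm).2 (.inl ⟨hxm, hx⟩))
    · intro h x hx
      by_cases hxA : x ∈ A
      · exact (hA x hxA).trans (h m hm)
      · rcases (mem_replace_of_mem hm).1 hx with hx | hx
        · exact hoff x hxA ▸ h x hx.2
        · exact absurd hx hxA
  ext i
  rw [mem_argmax, hub, mem_replace_of_mem hm]
  have hiff : i ∈ replace m B (argmax c' G) ↔
      i ≠ m ∧ i ∈ argmax c' G ∨ m ∈ argmax c' G ∧ i ∈ B := by
    by_cases h : m ∈ argmax c' G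
    · simp [mem_replace_of_mem h, h]
    · rw [replace_of_notMem h]
      simp only [h, false_and, or_false, iff_and_self]
      rintro hi rfl
      exact h hi
  rw [hiff, mem_argmax, mem_argmax]
  by_cases hiA : i ∈ A
  · by_cases hiB : i ∈ B
    · rw [heq i hiB]
      have := hG i
      tauto
    · have h1 : ¬ ∀ x ∈ G, c' x ≤ c i := fun h => (hlt i hiA hiB).not_ge (h m hm)
      have := hG i
      tauto
  · rw [hoff i hiA]
    have h1 : i ∉ B := fun h => hiA (hBA h)
    constructor
    · tauto
    · rintro ⟨h | h, h'⟩
      · exact .inl ⟨h.1, h.2, h'⟩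
      · exact absurd h hiA

/-- The faces on which all coordinates in `S` vanish. -/
lemma mem_faceTuples_sdiff {F G : Fin k → Finset (Fin r)} {S : Finset (Fin r)} :
    G ∈ faceTuples (fun j => F j \ S) ↔ G ∈ faceTuples F ∧ ∀ j, Disjoint S (G j) := by
  constructor
  · intro h
    obtain ⟨hF, c, rfl⟩ := mem_faceTuples.1 h
    -- Lowering `c` to `L` on `S` keeps `S` out of the maximizers, as each `F j` has an element
    -- outside `S`.
    obtain ⟨L, hL⟩ : ∃ L : ℝ, ∀ i, L < c i := by
      obtain ⟨L, hL⟩ := (Set.finite_range c).bddBelow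
      exact ⟨L - 1, fun i => by linarith [hL ⟨i, rfl⟩]⟩
    refine ⟨mem_faceTuples.2 ⟨fun j => (hF j).mono Finset.sdiff_subset,
      fun i => if i ∈ S then L else c i, ?_⟩,
      fun j => Finset.disjoint_sdiff.mono_right (argmax_subset _ _)⟩
    funext j
    ext i
    rw [mem_argmax, mem_argmax]
    obtain ⟨b, hb⟩ := hF j
    rw [Finset.mem_sdiff] at hb
    constructor
    · rintro ⟨hi, h⟩
      rw [Finset.mem_sdiff] at hi
      refine ⟨hi.1, fun x hx => ?_⟩
      rw [if_neg hi.2]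
      split_ifs with hxS
      · exact (hL i).le
      · exact h x (Finset.mem_sdiff.2 ⟨hx, hxS⟩)
    · rintro ⟨hi, h⟩
      have hiS : i ∉ S := fun hiS => by
        have := h b hb.1
        rw [if_pos hiS, if_neg hb.2] at this
        exact (hL b).not_ge this
      refine ⟨Finset.mem_sdiff.2 ⟨hi, hiS⟩, fun x hx => ?_⟩
      rw [Finset.mem_sdiff] at hx
      simpa [hiS, hx.2] using h x hx.1
  · rintro ⟨h, hS⟩
    obtain ⟨hF, c, rfl⟩ := mem_faceTuples.1 h
    have hsub (j : Fin k) : argmax c (F j) ⊆ F j \ S := fun i hi =>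
      Finset.mem_sdiff.2 ⟨argmax_subset _ _ hi, fun hi' => Finset.disjoint_left.1 (hS j) hi' hi⟩
    refine mem_faceTuples.2 ⟨fun j => (faceTuples_nonempty h j).mono (hsub j), c, ?_⟩
    funext j
    ext i
    constructor
    · intro hi
      exact mem_argmax.2 ⟨hsub j hi, fun x hx => (mem_argmax.1 hi).2 x (Finset.sdiff_subset hx)⟩
    · intro hi
      obtain ⟨b, hb⟩ := argmax_nonempty c (hF j)
      rw [mem_argmax] at hi
      exact mem_argmax.2 ⟨Finset.sdiff_subset hi.1, fun x hx =>
        ((mem_argmax.1 hb).2 x hx).trans (hi.2 b (hsub j hb))⟩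

/-! ### Dimension of the faces -/

section Dimension

/-- The span of the differences `e_a - e_b` for `a`, `b` in a common member of `G`. -/
def diffSpan {r k : ℕ} (G : Fin k → Finset (Fin r)) : Submodule ℝ (Fin r → ℝ) :=
  Submodule.span ℝ {x | ∃ j, ∃ a ∈ G j, ∃ b ∈ G j, x = Pi.single a 1 - Pi.single b 1}

lemma single_sub_single_mem_diffSpan {G : Fin k → Finset (Fin r)} {j : Fin k} {a b : Fin r}
    (ha : a ∈ G j) (hb : b ∈ G j) :
    (Pi.single a 1 - Pi.single b 1 : Fin r → ℝ) ∈ diffSpan G :=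
  Submodule.subset_span ⟨j, a, ha, b, hb, rfl⟩

lemma sub_mem_diffSpan {G : Fin k → Finset (Fin r)} {j : Fin k} {x y : Fin r → ℝ}
    (hx : x ∈ simplex (G j)) (hy : y ∈ simplex (G j)) : x - y ∈ diffSpan G := by
  obtain ⟨b, hb⟩ := nonempty_of_mem_simplex hx
  -- The `b`-terms cancel because `x` and `y` have the same coordinate sum.
  have h : x - y = ∑ a, (x a - y a) • (Pi.single a 1 - Pi.single b 1 : Fin r → ℝ) := by
    simp only [smul_sub, Finset.sum_sub_distrib, ← Finset.sum_smul, hx.1.2, hy.1.2, sub_self,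
      zero_smul, sub_zero]
    ext i
    simp [Finset.sum_apply, Pi.single_apply]
  rw [h]
  refine sum_mem fun a _ => ?_
  by_cases ha : a ∈ G j
  · exact Submodule.smul_mem _ _ (single_sub_single_mem_diffSpan ha hb)
  · simp [hx.2 a ha, hy.2 a ha]

lemma vectorSpan_minkowskiSum {G : Fin k → Finset (Fin r)} (hG : ∀ j, (G j).Nonempty) :
    vectorSpan ℝ (minkowskiSum G) = diffSpan G := by
  apply le_antisymm
  · refine Submodule.span_le.2 ?_
    rintro _ ⟨_, ⟨x, hx, rfl⟩, _, ⟨y, hy, rfl⟩, rfl⟩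
    simp only [vsub_eq_sub, ← Finset.sum_sub_distrib]
    exact sum_mem fun j _ => sub_mem_diffSpan (hx j) (hy j)
  · refine Submodule.span_le.2 ?_
    rintro _ ⟨j, a, ha, b, hb, rfl⟩
    choose i hi using hG
    -- Two points of the sum differing only in the `j`-th summand realize `e_a - e_b`.
    have hu {a : Fin r} (ha : a ∈ G j) (l : Fin k) : Function.update i j a l ∈ G l := by
      by_cases hl : l = j
      · subst hl
        simpa using ha
      · simpa [hl] using hi l
    have := vsub_mem_vectorSpan ℝ (sum_single_mem_minkowskiSum (hu ha))
      (sum_single_mem_minkowskiSum (hu hb))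
    rw [vsub_eq_sub, ← Finset.sum_sub_distrib, Finset.sum_eq_single j] at this
    · simpa using this
    · intro l _ hl
      simp [hl]
    · simp

lemma affDim_minkowskiSum {G : Fin k → Finset (Fin r)} (hG : ∀ j, (G j).Nonempty) :
    affDim (minkowskiSum G) = Module.finrank ℝ (diffSpan G) := by
  rw [affDim, vectorSpan_minkowskiSum hG]

lemma affDim_simplex {B : Finset (Fin r)} (hB : B.Nonempty) :
    affDim (simplex B) = Module.finrank ℝ (diffSpan fun _ : Fin 1 => B) := by
  rw [simplex_eq_minkowskiSum, affDim_minkowskiSum fun _ => hB]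

/-- Renaming `m` to `b₀` is a linear automorphism, so it preserves dimension; the other elements of
`B` differ from `b₀` by vectors in the span of `B`. That some member contains `m` ensures that all
of `B` ends up in one member. -/
lemma diffSpan_replace {m b₀ : Fin r} {A B : Finset (Fin r)} {G : Fin k → Finset (Fin r)}
    (hG : ∀ j, ∀ i ∈ G j, i ∈ A → i = m) (hBA : B ⊆ A) (hb₀ : b₀ ∈ B) (hm : ∃ j, m ∈ G j) :
    diffSpan (fun j => replace m B (G j)) =
      (diffSpan G).map (LinearEquiv.funCongrLeft ℝ ℝ (Equiv.swap m b₀)).toLinearMap ⊔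
        diffSpan fun _ : Fin 1 => B := by
  have hsingle (a : Fin r) : LinearEquiv.funCongrLeft ℝ ℝ (Equiv.swap m b₀) (Pi.single a 1) =
      Pi.single (Equiv.swap m b₀ a) 1 := by
    ext i
    simp [LinearEquiv.funCongrLeft_apply, LinearMap.funLeft_apply, Pi.single_apply,
      Equiv.swap_apply_eq_iff]
  have hfix {j : Fin k} {a : Fin r} (ha : a ∈ G j) (ham : a ≠ m) : Equiv.swap m b₀ a = a :=
    Equiv.swap_apply_of_ne_of_ne ham fun h => ham (hG j a ha (h ▸ hBA hb₀))
  apply le_antisymm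
  -- Modulo the span of `B`, each new unit vector is a renamed old one.
  · have key (j : Fin k) (a : Fin r) (ha : a ∈ replace m B (G j)) : ∃ a' ∈ G j,
        (Pi.single a 1 - Pi.single (Equiv.swap m b₀ a') 1 : Fin r → ℝ) ∈
          diffSpan fun _ : Fin 1 => B := by
      by_cases hmj : m ∈ G j
      · rcases (mem_replace_of_mem hmj).1 ha with ⟨ham, haG⟩ | haB
        · exact ⟨a, haG, by simp [hfix haG ham]⟩
        · refine ⟨m, hmj, ?_⟩
          rw [Equiv.swap_apply_left]
          exact single_sub_single_mem_diffSpan (j := 0) haB hb₀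
      · rw [replace_of_notMem hmj] at ha
        exact ⟨a, ha, by simp [hfix ha fun h => hmj (h ▸ ha)]⟩
    refine Submodule.span_le.2 ?_
    rintro _ ⟨j, a, ha, b, hb, rfl⟩
    obtain ⟨a', ha', h1⟩ := key j a ha
    obtain ⟨b', hb', h2⟩ := key j b hb
    have h3 : (Pi.single (Equiv.swap m b₀ a') 1 - Pi.single (Equiv.swap m b₀ b') 1 : Fin r → ℝ) ∈
        (diffSpan G).map (LinearEquiv.funCongrLeft ℝ ℝ (Equiv.swap m b₀)).toLinearMap :=
      ⟨_, single_sub_single_mem_diffSpan ha' hb', by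
        rw [LinearEquiv.coe_coe, map_sub, hsingle, hsingle]⟩
    have := add_mem (Submodule.mem_sup_left h3) (Submodule.mem_sup_right (sub_mem h1 h2))
    rwa [show ∀ u v s t : Fin r → ℝ, s - t + (u - s - (v - t)) = u - v by intros; abel] at this
  · refine sup_le ?_ ?_
    · rw [diffSpan, Submodule.map_span, Submodule.span_le]
      rintro _ ⟨_, ⟨j, a, ha, b, hb, rfl⟩, rfl⟩
      have key (a : Fin r) (ha : a ∈ G j) : Equiv.swap m b₀ a ∈ replace m B (G j) := by
        by_cases hmj : m ∈ G j
        · rw [mem_replace_of_mem hmj]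
          by_cases ham : a = m
          · simp [ham, hb₀]
          · rw [hfix ha ham]
            exact .inl ⟨ham, ha⟩
        · rwa [replace_of_notMem hmj, hfix ha fun h => hmj (h ▸ ha)]
      rw [LinearEquiv.coe_coe, map_sub, hsingle, hsingle]
      exact single_sub_single_mem_diffSpan (j := j) (key a ha) (key b hb)
    · refine Submodule.span_le.2 ?_
      rintro _ ⟨_, a, ha, b, hb, rfl⟩
      obtain ⟨j, hj⟩ := hm
      exact single_sub_single_mem_diffSpan (j := j) ((mem_replace_of_mem hj).2 (.inr ha))
        ((mem_replace_of_mem hj).2 (.inr hb))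

/-- After renaming, vectors of the first space vanish on `B` away from `b₀`; those of the second are
supported on `B` with coordinate sum zero. A common vector is supported at `b₀` and sums to zero, so
it is zero. -/
lemma disjoint_map_diffSpan {m b₀ : Fin r} {A B : Finset (Fin r)} {G : Fin k → Finset (Fin r)}
    (hG : ∀ j, ∀ i ∈ G j, i ∈ A → i = m) (hBA : B ⊆ A) (hb₀ : b₀ ∈ B) :
    Disjoint ((diffSpan G).map (LinearEquiv.funCongrLeft ℝ ℝ (Equiv.swap m b₀)).toLinearMap)
      (diffSpan fun _ : Fin 1 => B) := by
  rw [Submodule.disjoint_def]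
  rintro _ ⟨x, hx, rfl⟩ hB
  have h1 : ∀ i ∈ A, i ≠ m → x i = 0 := by
    intro i hi him
    refine Submodule.span_induction (p := fun x _ => x i = 0) ?_ rfl
      (fun x y _ _ hx hy => by simp [hx, hy]) (fun c x _ hx => by simp [hx]) hx
    rintro _ ⟨j, a, ha, b, hb, rfl⟩
    have hai : i ≠ a := fun h => him (hG j i (h ▸ ha) hi)
    have hbi : i ≠ b := fun h => him (hG j i (h ▸ hb) hi)
    simp [hai, hbi]
  have h2 : ∀ y ∈ diffSpan (fun _ : Fin 1 => B), (∀ i ∉ B, y i = 0) ∧ ∑ i, y i = 0 := by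
    intro y hy
    refine Submodule.span_induction (p := fun y _ => (∀ i ∉ B, y i = 0) ∧ ∑ i, y i = 0) ?_
      (by simp) (fun x y _ _ hx hy => ⟨fun i hi => by simp [hx.1 i hi, hy.1 i hi],
        by simp [Finset.sum_add_distrib, hx.2, hy.2]⟩)
      (fun c x _ hx => ⟨fun i hi => by simp [hx.1 i hi],
        by simp [← Finset.mul_sum, hx.2]⟩) hy
    rintro _ ⟨_, a, ha, b, hb, rfl⟩
    refine ⟨fun i hi => ?_, by simp⟩
    have hai : i ≠ a := fun h => hi (h ▸ ha)
    have hbi : i ≠ b := fun h => hi (h ▸ hb)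
    simp [hai, hbi]
  rw [LinearEquiv.coe_coe] at hB ⊢
  obtain ⟨h3, h4⟩ := h2 _ hB
  have h5 : ∀ i ≠ b₀, LinearEquiv.funCongrLeft ℝ ℝ (Equiv.swap m b₀) x i = 0 := by
    intro i hi
    by_cases hiB : i ∈ B
    · rw [LinearEquiv.funCongrLeft_apply, LinearMap.funLeft_apply]
      by_cases him : i = m
      · subst him
        rw [Equiv.swap_apply_left]
        exact h1 _ (hBA hb₀) hi.symm
      · rw [Equiv.swap_apply_of_ne_of_ne him hi]
        exact h1 _ (hBA hiB) him
    · exact h3 i hiB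
  ext i
  by_cases hi : i = b₀
  · rw [Finset.sum_eq_single b₀ (fun i _ hi => h5 i hi)
      fun h => absurd (Finset.mem_univ _) h] at h4
    rw [hi]
    exact h4
  · exact h5 i hi

lemma affDim_minkowskiSum_replace {m : Fin r} {A B : Finset (Fin r)} {G : Fin k → Finset (Fin r)}
    (hG : ∀ j, ∀ i ∈ G j, i ∈ A → i = m) (hBA : B ⊆ A) (hB : B.Nonempty) (hm : ∃ j, m ∈ G j)
    (hne : ∀ j, (G j).Nonempty) :
    affDim (minkowskiSum fun j => replace m B (G j)) =
      affDim (simplex B) + affDim (minkowskiSum G) := by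
  obtain ⟨b₀, hb₀⟩ := id hB
  rw [affDim_minkowskiSum fun j => (replace_nonempty_iff hB).2 (hne j), affDim_minkowskiSum hne,
    affDim_simplex hB, diffSpan_replace hG hBA hb₀ hm]
  have h := Submodule.finrank_sup_add_finrank_inf_eq
    ((diffSpan G).map (LinearEquiv.funCongrLeft ℝ ℝ (Equiv.swap m b₀)).toLinearMap)
    (diffSpan fun _ : Fin 1 => B)
  rw [(disjoint_map_diffSpan hG hBA hb₀).eq_bot, finrank_bot, add_zero,
    LinearEquiv.finrank_map_eq] at h
  rw [h, add_comm]

end Dimension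

/-! ### Counting faces by the substitution bijection -/

/-- The sum over the faces of `P_𝓕`, where `A` is replaced by `m` in `𝓕'` and `𝓕` is recovered
by `replace`. -/
lemma fPoly_minkowskiSum_replace {m : Fin r} {A : Finset (Fin r)} (hm : m ∈ A)
    (F : Fin k → Finset (Fin r)) (hF : ∀ j, ∀ i ∈ F j, i ∈ A → i = m) :
    fPoly (minkowskiSum fun j => replace m A (F j)) =
      fPoly (simplex A) * fPoly (minkowskiSum F)
        - fPoly (simplex A) * fPoly (minkowskiSum fun j => F j \ {m})
        + fPoly (minkowskiSum fun j => F j \ {m}) := by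
  classical
  have hGF {G : Fin k → Finset (Fin r)} (hG : G ∈ faceTuples F) (j : Fin k) :
      ∀ i ∈ G j, i ∈ A → i = m := by
    obtain ⟨-, c, rfl⟩ := mem_faceTuples.1 hG
    exact fun i hi => hF j i (argmax_subset _ _ hi)
  have hsdiff : (fun j => replace m A (F j) \ A) = fun j => F j \ {m} := by
    funext j
    ext i
    have := hF j i
    by_cases h : m ∈ F j
    · rw [Finset.mem_sdiff, mem_replace_of_mem h, Finset.mem_sdiff, Finset.mem_singleton]
      have : i = m → i ∈ A := fun h => h ▸ hm
      tauto
    · rw [Finset.mem_sdiff, replace_of_notMem h, Finset.mem_sdiff, Finset.mem_singleton]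
      have : i = m → i ∈ A := fun h => h ▸ hm
      tauto
  have h1 : (faceTuples fun j => replace m A (F j)).filter (fun G => ∀ j, Disjoint A (G j)) =
      faceTuples fun j => F j \ {m} := by
    ext G
    rw [Finset.mem_filter, ← mem_faceTuples_sdiff, hsdiff]
  have h2 : (faceTuples F).filter (fun G => ∀ j, Disjoint {m} (G j)) =
      faceTuples fun j => F j \ {m} := by
    ext G
    rw [Finset.mem_filter, ← mem_faceTuples_sdiff]
  have h3 : ∑ G ∈ (faceTuples fun j => replace m A (F j)).filter
        (fun G => ¬ ∀ j, Disjoint A (G j)), (X : ℤ[X]) ^ affDim (minkowskiSum G) =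
      (∑ B ∈ A.powerset.filter Finset.Nonempty, (X : ℤ[X]) ^ affDim (simplex B)) *
        ∑ G ∈ (faceTuples F).filter (fun G => ¬ ∀ j, Disjoint {m} (G j)),
          (X : ℤ[X]) ^ affDim (minkowskiSum G) := by
    have hmem {p : Finset (Fin r) × (Fin k → Finset (Fin r))}
        (hp : p ∈ A.powerset.filter Finset.Nonempty ×ˢ
          (faceTuples F).filter (fun G => ¬ ∀ j, Disjoint {m} (G j))) :
        p.1 ⊆ A ∧ p.1.Nonempty ∧ p.2 ∈ faceTuples F ∧ ∃ j, m ∈ p.2 j := by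
      simpa [and_assoc] using hp
    rw [Finset.sum_mul_sum, ← Finset.sum_product']
    symm
    refine Finset.sum_bij (fun p _ j => replace m p.1 (p.2 j)) ?_ ?_ ?_ ?_
    · intro p hp
      obtain ⟨hBA, hB, hG, j, hj⟩ := hmem hp
      obtain ⟨hFne, c', hc'⟩ := mem_faceTuples.1 hG
      refine Finset.mem_filter.2 ⟨mem_faceTuples.2 ⟨fun j =>
        (replace_nonempty_iff ⟨m, hm⟩).2 (hFne j),
        -- Any value below `c' m` would do on the part of `A` outside `B`.
        fun i => if i ∈ p.1 then c' m else if i ∈ A then c' m - 1 else c' i, ?_⟩, fun h => ?_⟩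
      · funext j
        rw [hc']
        refine replace_argmax (hF j) hBA hB (fun i hi => ?_) (fun i hi => ?_) fun i hi hi' => ?_
        · have hiB : i ∉ p.1 := fun h => hi (hBA h)
          simp [hi, hiB]
        · simp [hi]
        · simp [hi, hi']
      · obtain ⟨b, hb⟩ := hB
        exact Finset.disjoint_left.1 (h j) (hBA hb) ((mem_replace_of_mem hj).2 (.inr hb))
    -- The pair is recovered from the substituted tuple: `B` is the trace on `A` of any member
    -- meeting `A`, and `m` belonged to exactly the members meeting `A`.
    · have hB {p : Finset (Fin r) × (Fin k → Finset (Fin r))}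
          (hp : p.1 ⊆ A ∧ p.1.Nonempty ∧ p.2 ∈ faceTuples F ∧ ∃ j, m ∈ p.2 j)
          {j : Fin k} (hj : m ∈ p.2 j) : p.1 = A ∩ replace m p.1 (p.2 j) := by
        obtain ⟨hBA, hB, hG, -⟩ := hp
        ext i
        rw [Finset.mem_inter, mem_replace_of_mem hj]
        have := hGF hG j i
        have := @hBA i
        tauto
      have hG {p : Finset (Fin r) × (Fin k → Finset (Fin r))}
          (hp : p.1 ⊆ A ∧ p.1.Nonempty ∧ p.2 ∈ faceTuples F ∧ ∃ j, m ∈ p.2 j)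
          (j : Fin k) (i : Fin r) :
          i ∈ p.2 j ↔ i = m ∧ (∃ a ∈ A, a ∈ replace m p.1 (p.2 j)) ∨
            i ∉ A ∧ i ∈ replace m p.1 (p.2 j) := by
        obtain ⟨hBA, ⟨b, hb⟩, hG, -⟩ := hp
        have h1 := hGF hG j i
        by_cases hj : m ∈ p.2 j
        · have h2 : ∃ a ∈ A, a ∈ replace m p.1 (p.2 j) :=
            ⟨b, hBA hb, (mem_replace_of_mem hj).2 (.inr hb)⟩
          rw [mem_replace_of_mem hj]
          have h3 := @hBA i
          have h4 : i = m → i ∈ p.2 j := fun h => h ▸ hj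
          have h5 : i = m → i ∈ A := fun h => h ▸ hm
          simp only [h2, and_true]
          tauto
        · rw [replace_of_notMem hj]
          have h2 : ¬ ∃ a ∈ A, a ∈ p.2 j := by
            rintro ⟨a, ha, haj⟩
            exact hj (hGF hG j a haj ha ▸ haj)
          have h3 : i = m → i ∉ p.2 j := fun h => h ▸ hj
          simp only [h2, and_false, false_or]
          tauto
      intro p hp q hq h
      have hp := hmem hp
      have hq := hmem hq
      have hpq (j : Fin k) : replace m p.1 (p.2 j) = replace m q.1 (q.2 j) := congrFun h j
      have h2 : p.2 = q.2 := by
        funext j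
        ext i
        rw [hG hp, hG hq, hpq]
      obtain ⟨-, -, -, j, hj⟩ := id hp
      refine Prod.ext ?_ h2
      rw [hB hp hj, hpq, ← hB hq (h2 ▸ hj)]
    · intro G hG
      obtain ⟨hG, hd⟩ := Finset.mem_filter.1 hG
      obtain ⟨hne, c, rfl⟩ := mem_faceTuples.1 hG
      have hB := argmax_nonempty c ⟨m, hm⟩
      obtain ⟨b, hb⟩ := id hB
      -- The functional for `G` gives `m` the value `c b`, the maximum of `c` on `A`.
      have hrep (j : Fin k) : replace m (argmax c A) (argmax (Function.update c m (c b)) (F j)) =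
          argmax c (replace m A (F j)) := by
        refine replace_argmax (hF j) (argmax_subset c A) hB (fun i hi => ?_) (fun i hi => ?_)
          fun i hi hi' => ?_
        · rw [Function.update_of_ne]
          rintro rfl
          exact hi hm
        · rw [Function.update_self]
          exact le_antisymm ((mem_argmax.1 hb).2 i (argmax_subset _ _ hi))
            ((mem_argmax.1 hi).2 b (argmax_subset _ _ hb))
        · rw [Function.update_self]
          by_contra! hle
          exact hi' (mem_argmax.2 ⟨hi, fun x hx => ((mem_argmax.1 hb).2 x hx).trans hle⟩)
      have hG' : (fun j => argmax (Function.update c m (c b)) (F j)) ∈ faceTuples F :=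
        mem_faceTuples.2 ⟨fun j => (replace_nonempty_iff ⟨m, hm⟩).1 (hne j), _, rfl⟩
      refine ⟨(argmax c A, fun j => argmax (Function.update c m (c b)) (F j)), ?_, funext hrep⟩
      simp only [Finset.mem_product, Finset.mem_filter, Finset.mem_powerset]
      refine ⟨⟨argmax_subset _ _, hB⟩, hG', fun h => hd fun j => ?_⟩
      -- Were `m` absent from every member, nothing would be substituted and the tuple would avoid
      -- `A`, contrary to `hd`.
      have hmj := Finset.disjoint_singleton_left.1 (h j)
      beta_reduce
      rw [← hrep, replace_of_notMem hmj]
      exact Finset.disjoint_left.2 fun i hi hi' => hmj (hGF hG' j i hi' hi ▸ hi')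
    · intro p hp
      obtain ⟨hBA, hB, hG, hj⟩ := hmem hp
      rw [affDim_minkowskiSum_replace (hGF hG) hBA hB hj (faceTuples_nonempty hG), pow_add]
  have hP := fPoly_minkowskiSum fun j => replace m A (F j)
  have hP' := fPoly_minkowskiSum F
  rw [← Finset.sum_filter_add_sum_filter_not _ (fun G => ∀ j, Disjoint A (G j)), h1, h3,
    ← fPoly_minkowskiSum, ← fPoly_eq_sum _ _ (bijOn_faces_simplex A)] at hP
  rw [← Finset.sum_filter_add_sum_filter_not _ (fun G => ∀ j, Disjoint {m} (G j)), h2,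
    ← fPoly_minkowskiSum] at hP'
  rw [hP, hP']
  ring

/-- Coordinates of the summands are nonnegative, so the `m`-th vanishes on the sum only if it does
on each summand. If some `F j` is contained in `{m}`, both sides are empty. -/
lemma minkowskiSum_inter_coord_eq_zero (F : Fin k → Finset (Fin r)) (m : Fin r) :
    {y | y ∈ minkowskiSum F ∧ y m = 0} = minkowskiSum fun j => F j \ {m} := by
  ext y
  constructor
  · rintro ⟨⟨x, hx, rfl⟩, h⟩
    rw [Finset.sum_apply, Finset.sum_eq_zero_iff_of_nonneg fun j _ => (hx j).1.1 m] at h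
    refine ⟨x, fun j => ⟨(hx j).1, fun i hi => ?_⟩, rfl⟩
    by_cases him : i = m
    · rw [him]
      exact h j (Finset.mem_univ j)
    · exact (hx j).2 i fun h => hi (by simp [h, him])
  · rintro ⟨x, hx, rfl⟩
    refine ⟨⟨x, fun j => simplex_mono Finset.sdiff_subset (hx j), rfl⟩, ?_⟩
    rw [Finset.sum_apply]
    exact Finset.sum_eq_zero fun j _ => (hx j).2 m (by simp)

lemma fPoly_simplex_prod_minkowskiSum (A : Finset (Fin r)) (F : Fin k → Finset (Fin r)) :
    fPoly (simplex A ×ˢ minkowskiSum F) = fPoly (simplex A) * fPoly (minkowskiSum F) :=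
  fPoly_prod _ _ (bijOn_faces_simplex A) _ _ (bijOn_faces F)

/-! ### Recovering `𝓕` from `𝓕'` -/

section Collapse

variable {F : Fin k → Finset (Fin r)} {A : Finset (Fin r)} {hA : A.Nonempty}

/-- With equal patterns, a member containing one element of `A` contains them all. -/
lemma disjoint_of_pattern_eq (hN : ∀ i₁ ∈ A, ∀ i₂ ∈ A, pattern F i₁ = pattern F i₂) {j : Fin k}
    (hj : ¬ A ⊆ F j) : Disjoint A (F j) := by
  refine Finset.disjoint_left.2 fun i hi hij => hj fun i' hi' => ?_
  have h : j ∈ pattern F i := by simpa [pattern] using hij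
  rw [hN i hi i' hi'] at h
  simpa [pattern] using h

lemma eq_max'_of_mem_collapse (hN : ∀ i₁ ∈ A, ∀ i₂ ∈ A, pattern F i₁ = pattern F i₂) (j : Fin k) :
    ∀ i ∈ collapse F A hA j, i ∈ A → i = A.max' hA := by
  intro i hi hiA
  by_cases hj : A ⊆ F j
  · simpa [collapse, hj, hiA] using hi
  · simp only [collapse, hj, if_false] at hi
    exact absurd hi (Finset.disjoint_left.1 (disjoint_of_pattern_eq hN hj) hiA)

lemma replace_collapse (hN : ∀ i₁ ∈ A, ∀ i₂ ∈ A, pattern F i₁ = pattern F i₂) :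
    (fun j => replace (A.max' hA) A (collapse F A hA j)) = F := by
  funext j
  by_cases hj : A ⊆ F j
  · ext i
    have h1 := @hj i
    have h2 : i = A.max' hA → i ∈ A := fun h => h ▸ A.max'_mem hA
    rw [mem_replace_of_mem (by simp [collapse, hj])]
    simp only [collapse, hj, if_true, Finset.mem_union, Finset.mem_sdiff, Finset.mem_singleton]
    tauto
  · have h := Finset.disjoint_left.1 (disjoint_of_pattern_eq hN hj) (A.max'_mem hA)
    simp only [collapse, hj, if_false]
    exact replace_of_notMem h

end Collapse

end SimplexSum

theorem mainTheorem12 {r k : ℕ} (F : Fin k → Finset (Fin r)) (A : Finset (Fin r))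
    (hA : A.Nonempty)
    (hN : ∀ i₁ ∈ A, ∀ i₂ ∈ A, SimplexSum.pattern F i₁ = SimplexSum.pattern F i₂) :
    SimplexSum.fPoly (SimplexSum.minkowskiSum F) =
        SimplexSum.fPoly (SimplexSum.simplex A) *
            SimplexSum.fPoly (SimplexSum.minkowskiSum (SimplexSum.collapse F A hA))
          - SimplexSum.fPoly (SimplexSum.simplex A) *
            SimplexSum.fPoly (SimplexSum.collapseFace F A hA)
          + SimplexSum.fPoly (SimplexSum.collapseFace F A hA) ∧
    SimplexSum.fPoly (SimplexSum.minkowskiSum F) =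
        SimplexSum.fPoly
            (SimplexSum.simplex A ×ˢ SimplexSum.minkowskiSum (SimplexSum.collapse F A hA))
          - SimplexSum.fPoly (SimplexSum.simplex A ×ˢ SimplexSum.collapseFace F A hA)
          + SimplexSum.fPoly (SimplexSum.collapseFace F A hA) := by
  have hface : SimplexSum.collapseFace F A hA =
      SimplexSum.minkowskiSum fun j => SimplexSum.collapse F A hA j \ {A.max' hA} :=
    SimplexSum.minkowskiSum_inter_coord_eq_zero _ _
  have key := SimplexSum.fPoly_minkowskiSum_replace (A.max'_mem hA) (SimplexSum.collapse F A hA)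
    (SimplexSum.eq_max'_of_mem_collapse hN)
  rw [SimplexSum.replace_collapse hN] at key
  rw [hface, SimplexSum.fPoly_simplex_prod_minkowskiSum, SimplexSum.fPoly_simplex_prod_minkowskiSum]
  exact ⟨key, key⟩
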